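/- Let $T$ be a locally finite tree with root $v_0$ and without leaves, that is, every vertex has at least one child (a neighbour farther from $v_0$). Let $\partial T$ be the set of infinite paths $\xi=(\xi_0,\xi_1,\dots)$ with $\xi_0=v_0$ and $\xi_{n+1}$ a child of $\xi_n$ for all $n$, with the topology of the visual metric $d(\xi,\xi')=2^{-N(\xi,\xi')}$ for $\xi\ne\xi'$ (and $d(\xi,\xi)=0$), where $N(\xi,\xi')$ is the smallest $n$ such that $\xi_n\neq\xi'_n$. For a vertex $v$ let $\partial T_v$ be the clopen ball of all $\xi\in\partial T$ that pass through $v$. Fix for every vertex $v$ a total order $<_v$ on the set of children of $v$, and order $\partial T$ by declaring $\xi<\xi'$ if $\xi\ne\xi'$ and $\xi_n<_{\xi_{n-1}}\xi'_n$ for $n=N(\xi,\xi')$. Let $V_T$ be the group of all homeomorphisms $g$ of $\partial T$ for which there are a finite partition of $\partial T$ into clopen balls $D_1,\dots,D_n$, each of the form $\partial T_v$, and positive numbers $\lambda_1,\dots,\lambda_n$ such that, for every $j$, $d(g(y),g(z))=\lambda_j\,d(y,z)$ for all $y,z\in D_j$ and $g|_{D_j}$ is order-preserving. Let $H$ be a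 finitely generated subgroup of $V_T$. Then the action of $H$ on $\partial T$ has a finite orbit, or it admits a ping-pong pair, that is, there exist $g,h\in H$ and pairwise disjoint open sets $U_1,U_2,V_1,V_2\subseteq\partial T$ such that $$g(\partial T\setminus U_1)\subseteq V_1\quad\text{and}\quad h(\partial T\setminus U_2)\subseteq V_2 .$$ -/

import Mathlib

/-- A locally finite rooted tree without leaves (every vertex has a child, that is, a neighbour
farther away from the root). -/
structure LFRootedTree (V : Type*) where
  graph : SimpleGraph V
  isTree : graph.IsTree
  locallyFinite : ∀ v, (graph.neighborSet v).Finite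
  root : V
  noLeaves : ∀ v, ∃ w, graph.Adj v w ∧ graph.dist root w = graph.dist root v + 1

namespace LFRootedTree

variable {V : Type*} (T : LFRootedTree V)

/-- `w` is a child of `v`: the edge from `v` to `w` is directed away from the root. -/
def IsChild (v w : V) : Prop :=
  T.graph.Adj v w ∧ T.graph.dist T.root w = T.graph.dist T.root v + 1

/-- The boundary `∂T`: one-sided infinite directed paths starting at the root. -/
@[ext] structure Boundary where
  vertex : ℕ → V
  vertex_zero : vertex 0 = T.root
  isChild : ∀ n, T.IsChild (vertex n) (vertex (n + 1))

variable {T}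

instance : CoeFun T.Boundary (fun _ => ℕ → V) := ⟨Boundary.vertex⟩

theorem Boundary.coe_injective :
    Function.Injective (fun ξ : T.Boundary => ξ.vertex) := fun _ _ h => Boundary.ext h

/-- The visual metric: `d(ξ, η) = 2 ^ (-N)` with `N` the smallest `n` such that `ξ n ≠ η n`,
and `d(ξ, ξ) = 0`. The topology of `∂T` is the one of this metric. -/
noncomputable instance : MetricSpace T.Boundary where
  dist ξ η := open Classical in
    if ξ = η then 0 else (1 / 2 : ℝ) ^ PiNat.firstDiff ξ.vertex η.vertex
  dist_self ξ := by simp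
  dist_comm ξ η := by
    rcases eq_or_ne ξ η with rfl | h
    · rfl
    · simp only [h, h.symm, if_false, PiNat.firstDiff_comm ξ.vertex]
  dist_triangle ξ η ζ := by
    rcases eq_or_ne ξ ζ with rfl | h
    · simp only [if_true]; split_ifs <;> positivity
    rcases eq_or_ne ξ η with rfl | h₁
    · simp
    rcases eq_or_ne η ζ with rfl | h₂
    · simp
    have hv : ∀ {a b : T.Boundary}, a ≠ b → a.vertex ≠ b.vertex :=
      fun hab e => hab (Boundary.coe_injective e)
    have := PiNat.dist_triangle ξ.vertex η.vertex ζ.vertex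
    rw [PiNat.dist_eq_of_ne (hv h), PiNat.dist_eq_of_ne (hv h₁), PiNat.dist_eq_of_ne (hv h₂)] at this
    simpa only [h, h₁, h₂, if_false] using this
  eq_of_dist_eq_zero {ξ η} h := by
    by_contra hne
    simp [hne] at h

variable (T) in
/-- The clopen ball `∂T_v` of all ends passing through the vertex `v`. -/
def ball (v : V) : Set T.Boundary := {ξ | ∃ n, ξ n = v}

/-- `P` is an admissible partition for `g`: a finite partition of `∂T` into clopen balls such that
`g` multiplies the visual metric by a positive constant on each of them. -/
def IsAdmissible (g : T.Boundary ≃ₜ T.Boundary) (P : Set (Set T.Boundary)) : Prop :=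
  P.Finite ∧ Setoid.IsPartition P ∧ (∀ D ∈ P, ∃ v, D = T.ball v) ∧
    ∀ D ∈ P, ∃ c : ℝ, 0 < c ∧ ∀ y ∈ D, ∀ z ∈ D, dist (g y) (g z) = c * dist y z

/-- An almost automorphism of `T`. -/
def IsAlmostAutomorphism (g : T.Boundary ≃ₜ T.Boundary) : Prop := ∃ P, IsAdmissible g P

variable (T) in
/-- A family of (strict) total orders, one on the set of children of each vertex. -/
structure ChildOrders where
  /-- `lt v a b` is `a <_v b`; only its values on children `a`, `b` of `v` matter. -/
  lt : V → V → V → Prop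
  isStrictTotalOrder : ∀ v,
    IsStrictTotalOrder {w // T.IsChild v w} (fun a b => lt v a.1 b.1)

/-- The induced order on `∂T`: `ξ` and `η` agree exactly up to some index `n`, and
`ξ (n + 1) <_{ξ n} η (n + 1)`. -/
def ChildOrders.boundaryLT (o : T.ChildOrders) (ξ η : T.Boundary) : Prop :=
  ∃ n, (∀ m ≤ n, ξ m = η m) ∧ o.lt (ξ n) (ξ (n + 1)) (η (n + 1))

/-- A Higman-Thompson element: an almost automorphism with an admissible partition on each piece of
which it is order-preserving. -/
def IsHigmanThompson (o : T.ChildOrders) (g : T.Boundary ≃ₜ T.Boundary) : Prop :=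
  ∃ P, IsAdmissible g P ∧
    ∀ D ∈ P, ∀ ξ ∈ D, ∀ η ∈ D, o.boundaryLT ξ η → o.boundaryLT (g ξ) (g η)

/-! ### Higman-Thompson elements form a group -/

theorem IsHigmanThompson.isAlmostAutomorphism {o : T.ChildOrders} {g : T.Boundary ≃ₜ T.Boundary}
    (h : IsHigmanThompson o g) : IsAlmostAutomorphism g :=
  h.imp fun _ hP => hP.1

theorem IsChild.parent_unique {u v w : V} (hu : T.IsChild u w) (hv : T.IsChild v w) : u = v := by
  obtain ⟨p, hp⟩ := T.isTree.connected.exists_walk_length_eq_dist T.root u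
  obtain ⟨q, hq⟩ := T.isTree.connected.exists_walk_length_eq_dist T.root v
  have hp' : (p.concat hu.1).IsPath := by
    apply SimpleGraph.Walk.isPath_of_length_eq_dist
    rw [SimpleGraph.Walk.length_concat, hp, hu.2]
  have hq' : (q.concat hv.1).IsPath := by
    apply SimpleGraph.Walk.isPath_of_length_eq_dist
    rw [SimpleGraph.Walk.length_concat, hq, hv.2]
  have := (T.isTree.existsUnique_path T.root w).unique hp' hq'
  have := congrArg SimpleGraph.Walk.penultimate this
  simpa using this

theorem Boundary.dist_root (ξ : T.Boundary) (n : ℕ) : T.graph.dist T.root (ξ n) = n := by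
  induction n with
  | zero => rw [ξ.vertex_zero, SimpleGraph.dist_self]
  | succ n ih => rw [(ξ.isChild n).2, ih]

theorem Boundary.eq_of_le {ξ η : T.Boundary} {n : ℕ} (h : ξ n = η n) : ∀ m ≤ n, ξ m = η m := by
  induction n with
  | zero => intro m hm; obtain rfl : m = 0 := by omega
            exact h
  | succ n ih =>
    have h' : ξ n = η n := (ξ.isChild n).parent_unique (h ▸ η.isChild n)
    intro m hm
    rcases Nat.lt_or_ge m (n + 1) with h1 | h1
    · exact ih h' m (by omega)
    · obtain rfl : m = n + 1 := by omega
      exact h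

theorem mem_ball_vertex {ξ η : T.Boundary} {n : ℕ} : η ∈ T.ball (ξ n) ↔ η n = ξ n := by
  refine ⟨fun ⟨m, hm⟩ => ?_, fun h => ⟨n, h⟩⟩
  have := η.dist_root m
  rw [hm, ξ.dist_root n] at this
  rw [← this] at hm
  exact hm

theorem Boundary.dist_of_ne {ξ η : T.Boundary} (h : ξ ≠ η) :
    dist ξ η = (1 / 2 : ℝ) ^ PiNat.firstDiff ξ.vertex η.vertex := if_neg h

theorem exists_ball_subset {ξ : T.Boundary} {U : Set T.Boundary} (hU : U ∈ nhds ξ) :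
    ∃ n, T.ball (ξ n) ⊆ U := by
  obtain ⟨ε, hε, h⟩ := Metric.mem_nhds_iff.1 hU
  obtain ⟨n, hn⟩ := exists_pow_lt_of_lt_one hε (by norm_num : (1 / 2 : ℝ) < 1)
  refine ⟨n, fun η hη => h ?_⟩
  rw [mem_ball_vertex] at hη
  rw [Metric.mem_ball]
  by_cases hne : η = ξ
  · simpa [hne] using hε
  rw [Boundary.dist_of_ne hne]
  refine lt_of_le_of_lt (pow_le_pow_of_le_one (by norm_num) (by norm_num) ?_) hn
  by_contra hlt
  have hne' : η.vertex ≠ ξ.vertex := fun e => hne (Boundary.coe_injective e)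
  exact PiNat.apply_firstDiff_ne hne' (Boundary.eq_of_le hη _ (by omega))

theorem ball_mem_nhds (ξ : T.Boundary) (n : ℕ) : T.ball (ξ n) ∈ nhds ξ := by
  refine Metric.mem_nhds_iff.2 ⟨(1 / 2 : ℝ) ^ n, by positivity, fun η hη => ?_⟩
  rw [mem_ball_vertex]
  by_cases hne : η = ξ
  · rw [hne]
  rw [Metric.mem_ball, Boundary.dist_of_ne hne] at hη
  exact PiNat.apply_eq_of_lt_firstDiff
    ((pow_lt_pow_iff_right_of_lt_one₀ (by norm_num) (by norm_num)).1 hη)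

theorem ball_anti (ξ : T.Boundary) {m n : ℕ} (h : m ≤ n) : T.ball (ξ n) ⊆ T.ball (ξ m) := by
  intro η hη
  rw [mem_ball_vertex] at hη ⊢
  exact Boundary.eq_of_le hη m h

theorem finite_isChild (v : V) : {w | T.IsChild v w}.Finite :=
  (T.locallyFinite v).subset fun _ h => h.1

theorem finite_level (n : ℕ) : (Set.range fun ξ : T.Boundary => ξ n).Finite := by
  induction n with
  | zero => exact (Set.finite_singleton T.root).subset (by rintro _ ⟨ξ, rfl⟩; exact ξ.vertex_zero)
  | succ n ih =>
    refine (ih.biUnion fun v _ => finite_isChild (T := T) v).subset ?_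
    rintro _ ⟨ξ, rfl⟩
    exact Set.mem_biUnion ⟨ξ, rfl⟩ (ξ.isChild n)

/-- Compactness of the boundary, in the form of König's lemma. -/
theorem exists_uniform_level (Good : Set T.Boundary → Prop)
    (mono : ∀ A B, A ⊆ B → Good B → Good A) (h : ∀ ξ : T.Boundary, ∃ n, Good (T.ball (ξ n))) :
    ∃ N, ∀ ξ : T.Boundary, Good (T.ball (ξ N)) := by
  by_contra! hbad
  let Bad : V → Prop := fun v => ∀ N, ∃ ξ ∈ T.ball v, ¬ Good (T.ball (ξ N))
  have step : ∀ v, Bad v → ∃ w, T.IsChild v w ∧ Bad w := by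
    intro v hv
    by_contra! hc
    have hc' : ∀ w, ∃ N, T.IsChild v w → ∀ ξ ∈ T.ball w, Good (T.ball (ξ N)) := by
      intro w
      by_cases hw : T.IsChild v w
      · have := hc w hw
        simp only [Bad] at this
        push Not at this
        exact this.imp fun N hN _ => hN
      · exact ⟨0, fun h => absurd h hw⟩
    choose N hN using hc'
    obtain ⟨M, hM⟩ := ((finite_isChild (T := T) v).image N).bddAbove
    obtain ⟨ξ, ⟨n, hn⟩, hξ⟩ := hv M
    have hch : T.IsChild v (ξ (n + 1)) := hn ▸ ξ.isChild n
    exact hξ (mono _ _ (ball_anti ξ (hM ⟨_, hch, rfl⟩)) (hN _ hch ξ ⟨n + 1, rfl⟩))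
  choose! f hf using step
  have hroot : Bad T.root := fun N => by
    obtain ⟨ξ, hξ⟩ := hbad N
    exact ⟨ξ, ⟨0, ξ.vertex_zero⟩, hξ⟩
  have hall : ∀ n, Bad (f^[n] T.root) := by
    intro n
    induction n with
    | zero => exact hroot
    | succ n ih => rw [Function.iterate_succ_apply']; exact (hf _ ih).2
  let ξ : T.Boundary := ⟨fun n => f^[n] T.root, rfl, fun n => by
    rw [Function.iterate_succ_apply']; exact (hf _ (hall n)).1⟩
  obtain ⟨n, hn⟩ := h ξ
  obtain ⟨η, hη, hη'⟩ := hall n n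
  rw [mem_ball_vertex.1 (show η ∈ T.ball (ξ n) from hη)] at hη'
  exact hη' hn

/-- `g` is an order-preserving homothety on `A`. -/
def IsGoodOn (o : T.ChildOrders) (g : T.Boundary ≃ₜ T.Boundary) (A : Set T.Boundary) : Prop :=
  (∃ c : ℝ, 0 < c ∧ ∀ y ∈ A, ∀ z ∈ A, dist (g y) (g z) = c * dist y z) ∧
    ∀ ξ ∈ A, ∀ η ∈ A, o.boundaryLT ξ η → o.boundaryLT (g ξ) (g η)

theorem isHigmanThompson_iff_local (o : T.ChildOrders) (g : T.Boundary ≃ₜ T.Boundary) :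
    IsHigmanThompson o g ↔ ∀ ξ : T.Boundary, ∃ n, IsGoodOn o g (T.ball (ξ n)) := by
  constructor
  · rintro ⟨P, ⟨-, hpart, hball, hhom⟩, hord⟩ ξ
    obtain ⟨D, ⟨hD, hξ⟩, -⟩ := hpart.2 ξ
    obtain ⟨v, rfl⟩ := hball D hD
    obtain ⟨n, rfl⟩ := id hξ
    exact ⟨n, hhom _ hD, hord _ hD⟩
  · intro h
    obtain ⟨N, hN⟩ := exists_uniform_level (IsGoodOn o g)
      (fun A B hAB hB => ⟨hB.1.imp fun c hc => ⟨hc.1, fun y hy z hz => hc.2 y (hAB hy) z (hAB hz)⟩,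
        fun ξ hξ η hη => hB.2 ξ (hAB hξ) η (hAB hη)⟩) h
    refine ⟨Set.range fun ξ : T.Boundary => T.ball (ξ N), ⟨?_, ⟨?_, ?_⟩, ?_, ?_⟩, ?_⟩
    · refine ((finite_level (T := T) N).image T.ball).subset ?_
      rintro _ ⟨ξ, rfl⟩
      exact ⟨_, ⟨ξ, rfl⟩, rfl⟩
    · rintro ⟨ξ, hξ⟩
      have : ξ ∈ T.ball (ξ N) := ⟨N, rfl⟩
      simp only at hξ
      rw [hξ] at this
      exact this
    · intro ξ
      refine ⟨T.ball (ξ N), ⟨⟨ξ, rfl⟩, ⟨N, rfl⟩⟩, ?_⟩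
      rintro _ ⟨⟨η, rfl⟩, hη⟩
      simp only at hη ⊢
      rw [mem_ball_vertex.1 hη]
    · rintro _ ⟨ξ, rfl⟩; exact ⟨_, rfl⟩
    · rintro _ ⟨ξ, rfl⟩; exact (hN ξ).1
    · rintro _ ⟨ξ, rfl⟩; exact (hN ξ).2

theorem ChildOrders.boundaryLT_trichotomy (o : T.ChildOrders) (ξ η : T.Boundary) :
    o.boundaryLT ξ η ∨ ξ = η ∨ o.boundaryLT η ξ := by
  by_cases hne : ξ = η
  · exact Or.inr (Or.inl hne)
  have hne' : ξ.vertex ≠ η.vertex := fun e => hne (Boundary.coe_injective e)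
  have hd := PiNat.apply_firstDiff_ne hne'
  have hlt : ∀ m < PiNat.firstDiff ξ.vertex η.vertex, ξ m = η m :=
    fun m hm => PiNat.apply_eq_of_lt_firstDiff hm
  generalize PiNat.firstDiff ξ.vertex η.vertex = N at hd hlt
  obtain _ | n := N
  · exact absurd (ξ.vertex_zero.trans η.vertex_zero.symm) hd
  have hn : ξ n = η n := hlt n (by omega)
  have := o.isStrictTotalOrder (ξ n)
  rcases trichotomous_of (fun a b : {w // T.IsChild (ξ n) w} => o.lt (ξ n) a.1 b.1)
    ⟨ξ (n + 1), ξ.isChild n⟩ ⟨η (n + 1), hn ▸ η.isChild n⟩ with h | h | h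
  · exact Or.inl ⟨n, fun m hm => hlt m (by omega), h⟩
  · exact absurd (congrArg Subtype.val h) hd
  · exact Or.inr (Or.inr ⟨n, fun m hm => (hlt m (by omega)).symm, hn ▸ h⟩)

theorem ChildOrders.boundaryLT_irrefl (o : T.ChildOrders) (ξ : T.Boundary) :
    ¬ o.boundaryLT ξ ξ := by
  rintro ⟨n, -, h⟩
  have := o.isStrictTotalOrder (ξ n)
  exact irrefl_of (fun a b : {w // T.IsChild (ξ n) w} => o.lt (ξ n) a.1 b.1)
    ⟨ξ (n + 1), ξ.isChild n⟩ h

theorem ChildOrders.boundaryLT_asymm (o : T.ChildOrders) {ξ η : T.Boundary}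
    (h : o.boundaryLT ξ η) : ¬ o.boundaryLT η ξ := by
  obtain ⟨n, hn, h⟩ := h
  rintro ⟨m, hm, h'⟩
  have key : ∀ k, ξ k = η k → o.lt (ξ k) (ξ (k + 1)) (η (k + 1)) → ξ (k + 1) ≠ η (k + 1) := by
    intro k hk hlt he
    have := o.isStrictTotalOrder (ξ k)
    rw [← he] at hlt
    exact irrefl_of (fun a b : {w // T.IsChild (ξ k) w} => o.lt (ξ k) a.1 b.1)
      ⟨ξ (k + 1), ξ.isChild k⟩ hlt
  have key' : ∀ k, ξ k = η k → o.lt (η k) (η (k + 1)) (ξ (k + 1)) → ξ (k + 1) ≠ η (k + 1) := by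
    intro k hk hlt he
    have := o.isStrictTotalOrder (η k)
    rw [he] at hlt
    exact irrefl_of (fun a b : {w // T.IsChild (η k) w} => o.lt (η k) a.1 b.1)
      ⟨η (k + 1), η.isChild k⟩ hlt
  rcases lt_trichotomy n m with hnm | rfl | hnm
  · exact key n (hn n le_rfl) h (hm (n + 1) hnm).symm
  · have := o.isStrictTotalOrder (ξ n)
    have hs := hn n le_rfl
    rw [← hs] at h'
    exact asymm_of (fun a b : {w // T.IsChild (ξ n) w} => o.lt (ξ n) a.1 b.1)
      (a := ⟨ξ (n + 1), ξ.isChild n⟩) (b := ⟨η (n + 1), hs ▸ η.isChild n⟩) h h'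
  · exact key' m (hm m le_rfl).symm h' (hn (m + 1) hnm)

variable (T) in
/-- The Higman-Thompson group `V_T` of the tree `T` (for a fixed family of orders), as a group of
homeomorphisms of `∂T`. -/
def higmanThompson (o : T.ChildOrders) : Subgroup (T.Boundary ≃ₜ T.Boundary) where
  carrier := {g | IsHigmanThompson o g}
  one_mem' := (isHigmanThompson_iff_local o 1).2 fun _ =>
    ⟨0, ⟨1, one_pos, fun y _ z _ => by simp⟩, fun _ _ _ _ h => h⟩
  mul_mem' {g h} hg hh := by
    simp only [Set.mem_ofPred_eq, isHigmanThompson_iff_local] at hg hh ⊢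
    intro ξ
    obtain ⟨m, ⟨a, ha, hma⟩, hmo⟩ := hg (h ξ)
    obtain ⟨n, ⟨b, hb, hnb⟩, hno⟩ := hh ξ
    obtain ⟨k, hk⟩ := exists_ball_subset (ξ := ξ)
      (Filter.inter_mem (h.continuous.continuousAt (ball_mem_nhds (h ξ) m)) (ball_mem_nhds ξ n))
    refine ⟨k, ⟨a * b, mul_pos ha hb, fun y hy z hz => ?_⟩, fun η hη ζ hζ hlt => ?_⟩
    · rw [Homeomorph.mul_apply, Homeomorph.mul_apply, hma _ (hk hy).1 _ (hk hz).1,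
        hnb _ (hk hy).2 _ (hk hz).2, mul_assoc]
    · exact hmo _ (hk hη).1 _ (hk hζ).1 (hno _ (hk hη).2 _ (hk hζ).2 hlt)
  inv_mem' {g} hg := by
    simp only [Set.mem_ofPred_eq, isHigmanThompson_iff_local] at hg ⊢
    intro ξ
    obtain ⟨m, ⟨a, ha, hma⟩, hmo⟩ := hg (g.symm ξ)
    obtain ⟨k, hk⟩ := exists_ball_subset (ξ := ξ)
      (g.symm.continuous.continuousAt (ball_mem_nhds (g.symm ξ) m))
    refine ⟨k, ⟨a⁻¹, inv_pos.2 ha, fun y hy z hz => ?_⟩, fun η hη ζ hζ hlt => ?_⟩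
    · have := hma _ (hk hy) _ (hk hz)
      rw [g.apply_symm_apply, g.apply_symm_apply] at this
      change dist (g.symm y) (g.symm z) = _
      rw [this, inv_mul_cancel_left₀ ha.ne']
    · change o.boundaryLT (g.symm η) (g.symm ζ)
      rcases o.boundaryLT_trichotomy (g.symm η) (g.symm ζ) with h | h | h
      · exact h
      · rw [g.symm.injective h] at hlt
        exact absurd hlt (o.boundaryLT_irrefl _)
      · have := hmo _ (hk hζ) _ (hk hη) h
        rw [g.apply_symm_apply, g.apply_symm_apply] at this
        exact absurd this (o.boundaryLT_asymm hlt)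

end LFRootedTree

/-- The action on `X` of a group `H` of homeomorphisms has a finite orbit. -/
def HasFiniteOrbit {X : Type*} [TopologicalSpace X] (H : Subgroup (X ≃ₜ X)) : Prop :=
  ∃ x : X, {y | ∃ h ∈ H, h x = y}.Finite

/-- The action on `X` of a group `H` of homeomorphisms admits a ping-pong pair. -/
def HasPingPongPair {X : Type*} [TopologicalSpace X] (H : Subgroup (X ≃ₜ X)) : Prop :=
  ∃ g ∈ H, ∃ h ∈ H, ∃ U₁ U₂ V₁ V₂ : Set X,
    (IsOpen U₁ ∧ IsOpen U₂ ∧ IsOpen V₁ ∧ IsOpen V₂) ∧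
    (Disjoint U₁ U₂ ∧ Disjoint U₁ V₁ ∧ Disjoint U₁ V₂ ∧
      Disjoint U₂ V₁ ∧ Disjoint U₂ V₂ ∧ Disjoint V₁ V₂) ∧
    g '' U₁ᶜ ⊆ V₁ ∧ h '' U₂ᶜ ⊆ V₂

/-! Every element `g` of the Higman-Thompson group is tame: near each point some positive power of
`g` is trivial, or the point is attracted by a periodic point of `g`, or it is itself a repelling
periodic point. Hence the hyperbolic periodic points of `g` form a finite set `F`, and a suitable
power of `g` moves every point outside a given neighbourhood of `F` into that neighbourhood or fixes
it. If the hyperbolic sets of the elements of `H` cover the boundary, then finitely many of them do,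
and a composition of such powers carries the complement of any neighbourhood of a suitable finite
set into that neighbourhood. When all orbits are infinite, this finite set has four pairwise
disjoint translates, around which the ping-pong pair is found.

Both tameness and the covering come from following a cone of ends along a path in an orbit (the
powers of `g`, respectively an injective path in the Schreier graph of `H`). As there are finitely
many cones at a given level, some cone is mapped into itself, forwards or backwards; a map of a cone
onto a smaller one attracts, and an order-preserving map of a cone onto itself that preserves levels
is the identity. -/

open Filter Function Topology
open scoped Pointwise

/-! ### Infinite orbits -/

section InfiniteOrbits

variable {G X : Type*} [Group G] [MulAction G X] {A B : Set X}

/-- P. M. Neumann's lemma for finite sets, by B. H. Neumann's lemma on coverings by cosets: each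
`{g | g • a = b}` is empty or a coset of a stabilizer of infinite index. -/
theorem exists_disjoint_smul (h : ∀ x ∈ A, (MulAction.orbit G x).Infinite) (hA : A.Finite)
    (hB : B.Finite) : ∃ g : G, Disjoint (g • A) B := by
  classical
  by_contra! hmeet
  let k (i : X × X) : G := Classical.epsilon fun g => g • i.1 = i.2
  have hk (g : G) (a : X) : k (a, g • a) • a = g • a :=
    Classical.epsilon_spec (p := fun g' : G => g' • a = g • a) ⟨g, rfl⟩
  have hcover : ⋃ i ∈ (hA.prod hB).toFinset, k i • (MulAction.stabilizer G i.1 : Set G) =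
      Set.univ := by
    refine Set.eq_univ_of_forall fun g => ?_
    obtain ⟨_, ⟨a, ha, rfl⟩, hb⟩ := Set.not_disjoint_iff.1 (hmeet g)
    refine Set.mem_biUnion (x := (a, g • a)) (by simpa using ⟨ha, hb⟩) ?_
    rw [mem_leftCoset_iff, SetLike.mem_coe, MulAction.mem_stabilizer_iff, mul_smul,
      inv_smul_eq_iff, hk]
  obtain ⟨i, hi, hindex⟩ := Subgroup.exists_finiteIndex_of_leftCoset_cover hcover
  refine h i.1 ((Set.Finite.mem_toFinset _).1 hi).1 (Set.finite_of_ncard_ne_zero ?_)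
  rw [← MulAction.index_stabilizer]
  exact hindex.index_ne_zero

theorem exists_seq_pairwise_disjoint_smul (h : ∀ x ∈ A, (MulAction.orbit G x).Infinite)
    (hA : A.Finite) : ∃ g : ℕ → G, Pairwise (Disjoint on fun i => g i • A) := by
  have : Std.Symm (Disjoint on fun g : G => g • A) := ⟨fun _ _ h => h.symm⟩
  obtain ⟨g, -, hg⟩ := exists_seq_of_forall_finset_exists' (fun _ : G => True)
    (Disjoint on fun g : G => g • A) fun s _ => by
      obtain ⟨g, hg⟩ := exists_disjoint_smul h hA
        (s.finite_toSet.biUnion fun k _ => (hA.image (k • ·)))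
      exact ⟨g, trivial, fun k hk => (hg.mono_right (Set.subset_biUnion_of_mem hk)).symm⟩
  exact ⟨g, hg⟩

end InfiniteOrbits

section InjectiveChain

open Relation

variable {α : Type*} {r : α → α → Prop}

/-- One step of a loop-erased walk: `F` holds the points already visited before `b`. -/
theorem exists_rel_infinite_reachable_avoiding (hfin : ∀ a, {b | r a b}.Finite) {F : Set α} {b : α}
    (hinf : {z | ReflTransGen (fun x y => r x y ∧ y ∉ F) b z}.Infinite) :
    ∃ c, r b c ∧ c ∉ insert b F ∧
      {z | ReflTransGen (fun x y => r x y ∧ y ∉ insert b F) c z}.Infinite := by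
  by_contra! hcon
  have herase {z} (hz : ReflTransGen (fun x y => r x y ∧ y ∉ F) b z) : z = b ∨
      ∃ c, (r b c ∧ c ∉ insert b F) ∧
        ReflTransGen (fun x y => r x y ∧ y ∉ insert b F) c z := by
    induction hz with
    | refl => exact Or.inl rfl
    | @tail y z _ hyz ih =>
      by_cases hzb : z = b
      · exact Or.inl hzb
      have hzF : z ∉ insert b F := by simp [hzb, hyz.2]
      rcases ih with rfl | ⟨c, hc, hcy⟩
      · exact Or.inr ⟨z, ⟨hyz.1, hzF⟩, .refl⟩
      · exact Or.inr ⟨c, hc, hcy.tail ⟨hyz.1, hzF⟩⟩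
  refine hinf <| ((Set.finite_singleton b).union <|
    ((hfin b).subset fun c (hc : r b c ∧ c ∉ insert b F) => hc.1).biUnion
      fun c hc => hcon c hc.1 hc.2).subset fun z hz => ?_
  rcases herase hz with rfl | ⟨c, hc, hcz⟩
  · exact Or.inl rfl
  · exact Or.inr (Set.mem_biUnion hc hcz)

/-- A version of König's lemma. -/
theorem exists_injective_chain (hfin : ∀ a, {b | r a b}.Finite) {a : α}
    (hinf : {b | ReflTransGen r a b}.Infinite) :
    ∃ u : ℕ → α, u 0 = a ∧ (∀ i, r (u i) (u (i + 1))) ∧ Injective u := by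
  let State := {s : Set α × α //
    {z | ReflTransGen (fun x y => r x y ∧ y ∉ s.1) s.2 z}.Infinite}
  choose next hr hnotMem hnext using fun s : State =>
    exists_rel_infinite_reachable_avoiding hfin s.2
  let walk : ℕ → State := Nat.rec ⟨(∅, a), by simpa using hinf⟩
    fun _ s => ⟨(insert s.1.2 s.1.1, next s), hnext s⟩
  have hvisited {i j : ℕ} (hij : i < j) : (walk i).1.2 ∈ (walk j).1.1 := by
    induction j, hij using Nat.le_induction with
    | base => exact Set.mem_insert _ _
    | succ j _ ih => exact Set.mem_insert_of_mem _ ih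
  have hfresh (j : ℕ) : (walk j).1.2 ∉ (walk j).1.1 := by
    cases j with
    | zero => exact Set.notMem_empty _
    | succ j => exact hnotMem (walk j)
  refine ⟨fun i => (walk i).1.2, rfl, fun i => hr (walk i),
    fun i j (heq : (walk i).1.2 = (walk j).1.2) => ?_⟩
  rcases lt_trichotomy i j with hij | rfl | hij
  · exact absurd (heq ▸ hvisited hij) (hfresh j)
  · rfl
  · exact absurd (heq ▸ hvisited hij) (hfresh i)

variable {G X : Type*} [Group G] [MulAction G X] {S : Set G} {x : X}

theorem reflTransGen_smul_of_mem_closure {g : G} (hg : g ∈ Subgroup.closure S) (x : X) :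
    ReflTransGen (fun y z => ∃ s ∈ S ∪ S⁻¹, s • y = z) x (g • x) := by
  rw [← Subgroup.mem_toSubmonoid, Subgroup.closure_toSubmonoid] at hg
  induction hg using Submonoid.closure_induction_left with
  | one => rw [one_smul]
  | mul_left s hs g _ ih => exact ih.tail ⟨s, hs, (mul_smul s g x).symm⟩

theorem exists_seq_injective_smul (hS : S.Finite)
    (hx : (MulAction.orbit (Subgroup.closure S) x).Infinite) :
    ∃ w : ℕ → G, (∀ i, w i ∈ Subgroup.closure S) ∧ (∀ i, w (i + 1) * (w i)⁻¹ ∈ S ∪ S⁻¹) ∧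
      Injective fun i => w i • x := by
  obtain ⟨u, hu₀, hu, hinj⟩ := exists_injective_chain (a := x)
    (r := fun y z => ∃ s ∈ S ∪ S⁻¹, s • y = z)
    (fun y => (hS.union hS.inv).image (· • y))
    (hx.mono <| by rintro _ ⟨g, rfl⟩; exact reflTransGen_smul_of_mem_closure g.2 x)
  choose s hs hsu using hu
  let w : ℕ → G := Nat.rec 1 fun i g => s i * g
  have hw (i : ℕ) : w i • x = u i := by
    induction i with
    | zero => exact (one_smul G x).trans hu₀.symm
    | succ i ih => rw [← hsu, ← ih]; exact mul_smul (s i) (w i) x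
  have hstep (i : ℕ) : w (i + 1) * (w i)⁻¹ = s i := mul_inv_cancel_right (s i) (w i)
  refine ⟨w, fun i => ?_, fun i => hstep i ▸ hs i, by simpa only [hw] using hinj⟩
  induction i with
  | zero => exact Subgroup.one_mem _
  | succ i ih =>
    refine Subgroup.mul_mem _ ?_ ih
    exact (hs i).elim (fun h => Subgroup.subset_closure h)
      fun h => inv_mem_iff.1 (Subgroup.subset_closure h)

end InjectiveChain

/-! ### Contraction to finite sets -/

section HomeomorphAction

variable {X : Type*} [TopologicalSpace X]

instance homeomorphMulAction : MulAction (X ≃ₜ X) X where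
  smul g x := g x
  one_smul _ := rfl
  mul_smul _ _ _ := rfl

theorem HasFiniteOrbit.of_finite_orbit {H : Subgroup (X ≃ₜ X)} {x : X}
    (h : (MulAction.orbit H x).Finite) : HasFiniteOrbit H :=
  ⟨x, h.subset fun _ ⟨g, hg, hgx⟩ => ⟨⟨g, hg⟩, hgx⟩⟩

end HomeomorphAction

section ContractsTo

variable {X : Type*} [TopologicalSpace X] {H : Subgroup (X ≃ₜ X)} {A A₁ A₂ F F₁ F₂ : Set X}

/-- `H` contracts `A` to `F`: for every open `U ⊇ F` some element of `H` maps `F ∪ (A \ U)` into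
`U`. The points outside `A` and `U` may be either mapped into `U` or fixed; this makes it possible
to compose contractions of different sets. -/
def ContractsTo (H : Subgroup (X ≃ₜ X)) (A F : Set X) : Prop :=
  ∀ U, IsOpen U → F ⊆ U →
    ∃ g ∈ H, Set.MapsTo g F U ∧ ∀ x ∉ U, g x ∈ U ∨ (x ∉ A ∧ g x = x)

theorem ContractsTo.empty : ContractsTo H ∅ ∅ := fun _ _ _ =>
  ⟨1, H.one_mem, Set.mapsTo_empty _ _, fun x _ => Or.inr ⟨Set.notMem_empty x, rfl⟩⟩

theorem ContractsTo.mono (h : ContractsTo H A₂ F) (hA : A₁ ⊆ A₂) : ContractsTo H A₁ F :=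
  fun U hU hFU =>
    let ⟨g, hg, hgF, hgU⟩ := h U hU hFU
    ⟨g, hg, hgF, fun x hx => (hgU x hx).imp_right (And.imp_left (mt (@hA x)))⟩

/-- Contract first to `F₁`, then to `F₂`. Removing the finite sets `F₁ \ F₂` and `F₂ \ F₁` from the
neighbourhoods in use forces the points of one that do not belong to the other to be moved. -/
theorem ContractsTo.union [T1Space X] (h₁ : ContractsTo H A₁ F₁) (h₂ : ContractsTo H A₂ F₂)
    (hF₁ : F₁.Finite) (hF₂ : F₂.Finite) : ContractsTo H (A₁ ∪ A₂) (F₁ ∪ F₂) := by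
  intro U hU hFU
  obtain ⟨hF₁U, hF₂U⟩ := Set.union_subset_iff.1 hFU
  obtain ⟨g₂, hg₂, hg₂F₂, hg₂U⟩ := h₂ (U \ (F₁ \ F₂)) (hU.sdiff hF₁.sdiff.isClosed)
    fun x hx => ⟨hF₂U hx, fun h => h.2 hx⟩
  have hg₂F₁ : F₁ ⊆ g₂ ⁻¹' U := by
    intro x hx
    by_cases hx₂ : x ∈ F₂
    · exact (hg₂F₂ hx₂).1
    · rcases hg₂U x fun h => h.2 ⟨hx, hx₂⟩ with h | ⟨-, h⟩
      · exact h.1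
      · rw [Set.mem_preimage, h]
        exact hF₁U hx
  obtain ⟨g₁, hg₁, hg₁F₁, hg₁U⟩ := h₁ ((U ∩ g₂ ⁻¹' U) \ (F₂ \ F₁))
    ((hU.inter (hU.preimage g₂.continuous)).sdiff hF₂.sdiff.isClosed)
    fun x hx => ⟨⟨hF₁U hx, hg₂F₁ hx⟩, fun h => h.2 hx⟩
  refine ⟨g₂ * g₁, H.mul_mem hg₂ hg₁, fun x hx => ?_, fun x hx => ?_⟩
  · by_cases hx₁ : x ∈ F₁
    · exact (hg₁F₁ hx₁).1.2
    · have hx₂ : x ∈ F₂ := hx.resolve_left hx₁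
      rcases hg₁U x fun h => h.2 ⟨hx₂, hx₁⟩ with h | ⟨-, h⟩
      · exact h.1.2
      · rw [Homeomorph.mul_apply, h]
        exact (hg₂F₂ hx₂).1
  · rcases hg₁U x fun h => hx h.1.1 with h | ⟨hxA₁, h⟩
    · exact Or.inl h.1.2
    · rw [Homeomorph.mul_apply, h]
      exact (hg₂U x fun h => hx h.1).imp And.left
        fun h => ⟨not_or_intro hxA₁ h.1, h.2⟩

theorem ContractsTo.exists_image_compl_subset (h : ContractsTo H Set.univ F) {U V : Set X}
    (hU : IsOpen U) (hV : IsOpen V) {k l : X ≃ₜ X} (hk : k ∈ H) (hl : l ∈ H)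
    (hkU : k '' F ⊆ U) (hlV : l '' F ⊆ V) : ∃ g ∈ H, g '' Uᶜ ⊆ V := by
  obtain ⟨g, hg, -, hgU⟩ := h (k ⁻¹' U ∩ l ⁻¹' V)
    ((hU.preimage k.continuous).inter (hV.preimage l.continuous))
    (Set.subset_inter (Set.image_subset_iff.1 hkU) (Set.image_subset_iff.1 hlV))
  refine ⟨l * g * k⁻¹, H.mul_mem (H.mul_mem hl hg) (H.inv_mem hk), ?_⟩
  rintro _ ⟨x, hx, rfl⟩
  have hkx : k⁻¹ x ∉ k ⁻¹' U ∩ l ⁻¹' V := fun h => hx (by simpa using h.1)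
  exact ((hgU _ hkx).resolve_right fun h => h.1 (Set.mem_univ _)).2

theorem exists_pairwise_disjoint_isOpen [T2Space X] {ι : Type*} [Finite ι] {K : ι → Set X}
    (hK : ∀ i, IsCompact (K i)) (hdisj : Pairwise (Disjoint on K)) :
    ∃ W : ι → Set X, (∀ i, IsOpen (W i) ∧ K i ⊆ W i) ∧ Pairwise (Disjoint on W) :=
  Pairwise.exists_mem_filter_basis_of_disjoint
    (fun i j hij =>
      (SeparatedNhds.of_isCompact_isCompact (hK i) (hK j) (hdisj hij)).disjoint_nhdsSet)
    fun i => hasBasis_nhdsSet (K i)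

theorem ContractsTo.hasPingPongPair [T2Space X] (h : ContractsTo H Set.univ F) (hF : F.Finite)
    (hH : ¬ HasFiniteOrbit H) : HasPingPongPair H := by
  obtain ⟨k, hk⟩ := exists_seq_pairwise_disjoint_smul (G := H)
    (fun x _ hx => hH (.of_finite_orbit hx)) hF
  obtain ⟨W, hW, hdisj⟩ := exists_pairwise_disjoint_isOpen
    (K := fun i : Fin 4 => (k i : X ≃ₜ X) '' F) (fun i => (hF.image _).isCompact)
    (hk.comp_of_injective Fin.val_injective)
  have hmap (i j : Fin 4) : ∃ g ∈ H, g '' (W i)ᶜ ⊆ W j :=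
    h.exists_image_compl_subset (hW i).1 (hW j).1 (k i).2 (k j).2 (hW i).2 (hW j).2
  obtain ⟨g, hg, hgW⟩ := hmap 0 2
  obtain ⟨g', hg', hgW'⟩ := hmap 1 3
  exact ⟨g, hg, g', hg', W 0, W 1, W 2, W 3, ⟨(hW 0).1, (hW 1).1, (hW 2).1, (hW 3).1⟩,
    ⟨hdisj (by decide), hdisj (by decide), hdisj (by decide), hdisj (by decide),
      hdisj (by decide), hdisj (by decide)⟩, hgW, hgW'⟩

end ContractsTo

/-! ### Tame homeomorphisms -/

section Tame

variable {X : Type*} [TopologicalSpace X] {f g k : X ≃ₜ X} {B : Set X} {a x y : X}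

theorem pow_apply_eq_self (h : f x = x) (n : ℕ) : (f ^ n) x = x :=
  (MulAction.stabilizer (X ≃ₜ X) x).pow_mem h n

theorem zpow_apply_eq_self (h : f x = x) (p : ℤ) : (f ^ p) x = x :=
  (MulAction.stabilizer (X ≃ₜ X) x).zpow_mem h p

theorem apply_apply_of_semiconjBy (h : SemiconjBy k f g) (x : X) : k (f x) = g (k x) :=
  DFunLike.congr_fun h.eq x

/-- The iterates of `f` contract the open set `B` uniformly to its point `a`. -/
structure Attracts (f : X ≃ₜ X) (B : Set X) (a : X) : Prop where
  isOpen : IsOpen B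
  mem : a ∈ B
  nontrivial : B.Nontrivial
  eventually_mapsTo : ∀ U ∈ 𝓝 a, ∀ᶠ n : ℕ in atTop, Set.MapsTo (f ^ n) B U

namespace Attracts

theorem pow (h : Attracts f B a) {n : ℕ} (hn : n ≠ 0) : Attracts (f ^ n) B a where
  isOpen := h.isOpen
  mem := h.mem
  nontrivial := h.nontrivial
  eventually_mapsTo U hU := by
    simpa only [← pow_mul, id_eq] using
      (tendsto_id.const_mul_atTop' hn.bot_lt).eventually (h.eventually_mapsTo U hU)

theorem image (h : Attracts f B a) (hk : SemiconjBy k f g) : Attracts g (k '' B) (k a) where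
  isOpen := k.isOpenMap _ h.isOpen
  mem := ⟨a, h.mem, rfl⟩
  nontrivial := h.nontrivial.image k.injective
  eventually_mapsTo U hU := by
    filter_upwards [h.eventually_mapsTo (k ⁻¹' U) (k.continuous.continuousAt hU)] with n hn
    rintro _ ⟨y, hy, rfl⟩
    rw [← apply_apply_of_semiconjBy (hk.pow_right n)]
    exact hn hy

theorem apply_eq [T2Space X] (h : Attracts f B a) : f a = a :=
  isFixedPt_of_tendsto_iterate (x := a)
    (fun U hU => (h.eventually_mapsTo U hU).mono fun n hn => by
      change f^[n] a ∈ U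
      rw [show f^[n] a = (f ^ n) a from smul_iterate_apply f n a]
      exact hn h.mem)
    f.continuous.continuousAt

theorem eq_of_apply_eq [T1Space X] (h : Attracts f B a) (hy : y ∈ B) (hfix : f y = y) :
    y = a := by
  by_contra hne
  obtain ⟨n, hn⟩ :=
    (h.eventually_mapsTo {y}ᶜ (isOpen_compl_singleton.mem_nhds (Ne.symm hne))).exists
  exact hn hy (pow_apply_eq_self hfix n)

theorem eq_of_pow_apply_eq [T1Space X] {p : ℤ} (h : Attracts (g ^ p) B a) (hy : y ∈ B) {n : ℕ}
    (hn : n ≠ 0) (hper : (g ^ n) y = y) : y = a := by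
  refine (h.pow hn).eq_of_apply_eq hy ?_
  rw [← zpow_natCast, zpow_comm, zpow_natCast]
  exact zpow_apply_eq_self hper p

theorem apply_eq_of_commute [T2Space X] (h : Attracts f B a) (hk : Commute k f) (hka : k a ∈ B) :
    k a = a :=
  h.eq_of_apply_eq hka (by rw [← apply_apply_of_semiconjBy hk, h.apply_eq])

end Attracts

/-- Some positive power of `g` is the identity near `x`. -/
def IsLocallyPeriodicAt (g : X ≃ₜ X) (x : X) : Prop :=
  ∃ n ≠ 0, ∀ᶠ y in 𝓝 x, (g ^ n) y = y

theorem IsLocallyPeriodicAt.of_semiconjBy (hk : SemiconjBy k f g)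
    (h : IsLocallyPeriodicAt g (k x)) : IsLocallyPeriodicAt f x := by
  obtain ⟨n, hn, h⟩ := h
  refine ⟨n, hn, (k.continuous.continuousAt.eventually h).mono fun y hy => k.injective ?_⟩
  rwa [apply_apply_of_semiconjBy (hk.pow_right n)]

/-- The power `(g ^ p) ^ m` carries all of `B` near `a`, where a power of `g` is trivial if `x` is
locally periodic; then that power of `g` is trivial on `B`, although `a` is its only fixed point. -/
theorem Attracts.not_isLocallyPeriodicAt [T1Space X] {p : ℤ} (h : Attracts (g ^ p) B a)
    (hx : x ∈ B) : ¬ IsLocallyPeriodicAt g x := by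
  rintro ⟨n, hn, hper⟩
  obtain rfl := h.eq_of_pow_apply_eq hx hn hper.self_of_nhds
  obtain ⟨m, hm⟩ := (h.eventually_mapsTo _ hper).exists
  have hcomm : Commute ((g ^ p) ^ m) (g ^ n) :=
    (((Commute.refl g).zpow_left p).pow_left m).pow_right n
  have hB {y : X} (hy : y ∈ B) : y = x := by
    refine h.eq_of_pow_apply_eq hy hn (((g ^ p) ^ m).injective ?_)
    rw [apply_apply_of_semiconjBy hcomm]
    exact hm hy
  obtain ⟨y, hy, z, hz, hne⟩ := h.nontrivial
  exact hne ((hB hy).trans (hB hz).symm)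

/-- The points at which `g` is not locally periodic. -/
def hyperbolicSet (g : X ≃ₜ X) : Set X := {x | ¬ IsLocallyPeriodicAt g x}

/-- The periodic points of `g` at which `g` is not locally periodic. -/
def hyperbolicPeriodicPts (g : X ≃ₜ X) : Set X :=
  {x ∈ hyperbolicSet g | ∃ n ≠ 0, (g ^ n) x = x}

theorem mapsTo_pow_hyperbolicPeriodicPts (g : X ≃ₜ X) (n : ℕ) :
    Set.MapsTo (g ^ n) (hyperbolicPeriodicPts g) (hyperbolicPeriodicPts g) := by
  rintro x ⟨hx, m, hm, hper⟩
  refine ⟨mt (.of_semiconjBy ((Commute.refl g).pow_left n)) hx, m, hm, ?_⟩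
  rw [apply_apply_of_semiconjBy ((Commute.refl g).pow_pow m n), hper]

theorem Attracts.mem_hyperbolicPeriodicPts [T2Space X] {p : ℤ} (hp : p ≠ 0)
    (h : Attracts (g ^ p) B a) : a ∈ hyperbolicPeriodicPts g := by
  refine ⟨h.not_isLocallyPeriodicAt h.mem, p.natAbs, Int.natAbs_ne_zero.2 hp, ?_⟩
  rw [← zpow_natCast, ← Int.mul_sign_self, zpow_mul]
  exact zpow_apply_eq_self h.apply_eq _

/-- Every point of a tame homeomorphism is locally periodic, or attracted by a periodic point, or a
repelling periodic point. -/
def IsTameAt (g : X ≃ₜ X) (x : X) : Prop :=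
  IsLocallyPeriodicAt g x ∨ (∃ n ≠ 0, ∃ B a, Attracts (g ^ n) B a ∧ x ∈ B) ∨
    ∃ n ≠ 0, ∃ B, Attracts (g ^ n)⁻¹ B x

theorem IsTameAt.of_commute (hk : Commute k g) (h : IsTameAt g (k x)) : IsTameAt g x := by
  have hinv (n : ℕ) : Commute k⁻¹ (g ^ n) := hk.inv_left.pow_right n
  have hkx : k⁻¹ (k x) = x := k.symm_apply_apply x
  rcases h with h | ⟨n, hn, B, a, h, hx⟩ | ⟨n, hn, B, h⟩
  · exact Or.inl (h.of_semiconjBy hk)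
  · exact Or.inr (Or.inl ⟨n, hn, _, _, h.image (hinv n), k x, hx, hkx⟩)
  · exact Or.inr (Or.inr ⟨n, hn, _, hkx ▸ h.image (hinv n).inv_right⟩)

theorem IsTameAt.isLocallyPeriodicAt_or_attracts (h : IsTameAt g x) :
    IsLocallyPeriodicAt g x ∨ ∃ (p : ℤ) (B : Set X) (a : X), Attracts (g ^ p) B a ∧ x ∈ B := by
  rcases h with h | ⟨n, -, B, a, h, hx⟩ | ⟨n, -, B, h⟩
  · exact Or.inl h
  · exact Or.inr ⟨n, B, a, by rwa [zpow_natCast], hx⟩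
  · exact Or.inr ⟨-n, B, x, by rwa [zpow_neg, zpow_natCast], h.mem⟩

theorem eventually_forall_mem_of_isCompact {ι : Type*} {l : Filter ι} {K : Set X}
    {P : ι → X → Prop} (hK : IsCompact K) (h : ∀ x ∈ K, ∀ᶠ p in l ×ˢ 𝓝 x, P p.1 p.2) :
    ∀ᶠ i in l, ∀ x ∈ K, P i x :=
  (Filter.Eventually.curry (hK.mem_prod_nhdsSet_of_forall h)).mono fun _ hi =>
    Filter.Eventually.self_of_nhdsSet hi

theorem isOpen_hyperbolicSet [T1Space X] (hg : ∀ x, IsTameAt g x) : IsOpen (hyperbolicSet g) := by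
  refine isOpen_iff_mem_nhds.2 fun x hx => ?_
  obtain ⟨p, B, a, h, hxB⟩ := (hg x).isLocallyPeriodicAt_or_attracts.resolve_left hx
  exact mem_of_superset (h.isOpen.mem_nhds hxB) fun y hy => h.not_isLocallyPeriodicAt hy

theorem finite_hyperbolicPeriodicPts [CompactSpace X] [T1Space X] (hg : ∀ x, IsTameAt g x) :
    (hyperbolicPeriodicPts g).Finite := by
  have hlocal (x : X) : ∃ U ∈ 𝓝 x, (U ∩ hyperbolicPeriodicPts g).Finite := by
    rcases (hg x).isLocallyPeriodicAt_or_attracts with ⟨n, hn, h⟩ | ⟨p, B, a, h, hx⟩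
    · refine ⟨_, eventually_eventually_nhds.2 h, Set.finite_empty.subset ?_⟩
      exact fun y hy => hy.2.1 ⟨n, hn, hy.1⟩
    · refine ⟨B, h.isOpen.mem_nhds hx, (Set.finite_singleton a).subset ?_⟩
      rintro y ⟨hyB, -, n, hn, hper⟩
      exact h.eq_of_pow_apply_eq hyB hn hper
  choose U hU hfin using hlocal
  obtain ⟨t, ht⟩ := CompactSpace.elim_nhds_subcover U hU
  refine (t.finite_toSet.biUnion fun x _ => hfin x).subset fun y hy => ?_
  obtain ⟨x, hx, hyx⟩ := Set.mem_iUnion₂.1 (ht.ge (Set.mem_univ y))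
  exact Set.mem_biUnion hx ⟨hyx, hy⟩

theorem Attracts.eventually_factorial_mapsTo {n : ℕ} (h : Attracts (g ^ n) B a) (hn : n ≠ 0)
    {U : Set X} (hU : U ∈ 𝓝 a) : ∀ᶠ m : ℕ in atTop, Set.MapsTo (g ^ m.factorial) B U := by
  have hdiv : Tendsto (fun m : ℕ => m.factorial / n) atTop atTop :=
    (Nat.tendsto_div_const_atTop hn).comp factorial_tendsto_atTop
  filter_upwards [hdiv.eventually (h.eventually_mapsTo U hU), eventually_ge_atTop n] with m hm hnm
  rwa [← pow_mul, Nat.mul_div_cancel' (Nat.dvd_factorial hn.bot_lt hnm)] at hm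

theorem contractsTo_hyperbolicPeriodicPts [CompactSpace X] [T2Space X] {H : Subgroup (X ≃ₜ X)}
    (hgH : g ∈ H) (hg : ∀ x, IsTameAt g x) :
    ContractsTo H (hyperbolicSet g) (hyperbolicPeriodicPts g) := by
  intro U hU hFU
  let Good (m : ℕ) (y : X) : Prop :=
    (g ^ m.factorial) y ∈ U ∨ (y ∉ hyperbolicSet g ∧ (g ^ m.factorial) y = y)
  have hlocal (x : X) (hx : x ∈ Uᶜ) : ∀ᶠ p : ℕ × X in atTop ×ˢ 𝓝 x, Good p.1 p.2 := by
    rcases hg x with ⟨n, hn, h⟩ | ⟨n, hn, B, a, h, hxB⟩ | ⟨n, hn, B, h⟩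
    · filter_upwards [(eventually_ge_atTop n).prod_mk (eventually_eventually_nhds.2 h)]
        with ⟨m, y⟩ ⟨hm, hy⟩
      refine Or.inr ⟨not_not_intro ⟨n, hn, hy⟩, ?_⟩
      obtain ⟨j, hj⟩ := Nat.dvd_factorial hn.bot_lt hm
      rw [hj, pow_mul]
      exact pow_apply_eq_self hy.self_of_nhds j
    · have ha : a ∈ hyperbolicPeriodicPts g :=
        Attracts.mem_hyperbolicPeriodicPts (p := n) (mod_cast hn) (by rwa [zpow_natCast])
      filter_upwards [(h.eventually_factorial_mapsTo hn (hU.mem_nhds (hFU ha))).prod_mk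
        (h.isOpen.mem_nhds hxB)] with ⟨m, y⟩ ⟨hm, hy⟩
      exact Or.inl (hm hy)
    · exact absurd (hFU (Attracts.mem_hyperbolicPeriodicPts (p := -n) (by simpa using hn)
        (by rwa [zpow_neg, zpow_natCast]))) hx
  obtain ⟨m, hm⟩ := (eventually_forall_mem_of_isCompact (P := Good)
    hU.isClosed_compl.isCompact hlocal).exists
  exact ⟨g ^ m.factorial, H.pow_mem hgH _,
    (mapsTo_pow_hyperbolicPeriodicPts g _).mono_right hFU, hm⟩

theorem hasPingPongPair_of_isTameAt [CompactSpace X] [T2Space X] {H : Subgroup (X ≃ₜ X)}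
    (htame : ∀ g ∈ H, ∀ x, IsTameAt g x) (hcover : ∀ x, ∃ g ∈ H, x ∈ hyperbolicSet g)
    (hH : ¬ HasFiniteOrbit H) : HasPingPongPair H := by
  obtain ⟨F, hF, hc⟩ : ∃ F : Set X, F.Finite ∧ ContractsTo H Set.univ F := by
    refine isCompact_univ.induction_on (p := fun A => ∃ F : Set X, F.Finite ∧ ContractsTo H A F)
      ⟨∅, Set.finite_empty, .empty⟩ ?_ ?_ fun x _ => ?_
    · exact fun s t hst ⟨F, hF, hc⟩ => ⟨F, hF, hc.mono hst⟩
    · exact fun s t ⟨F₁, hF₁, hc₁⟩ ⟨F₂, hF₂, hc₂⟩ =>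
        ⟨F₁ ∪ F₂, hF₁.union hF₂, hc₁.union hc₂ hF₁ hF₂⟩
    · obtain ⟨g, hg, hx⟩ := hcover x
      exact ⟨_, mem_nhdsWithin_of_mem_nhds ((isOpen_hyperbolicSet (htame g hg)).mem_nhds hx), _,
        finite_hyperbolicPeriodicPts (htame g hg),
        contractsTo_hyperbolicPeriodicPts hg (htame g hg)⟩
  exact hc.hasPingPongPair hF hH

end Tame

/-! ### Maps of cones -/

namespace LFRootedTree

variable {V : Type*} {T : LFRootedTree V} {o : T.ChildOrders}

section Cones

variable {n : ℕ} {ξ η : T.Boundary}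

instance : CompactSpace T.Boundary := by
  refine ⟨isCompact_of_finite_subcover fun {ι} U hU hcover => ?_⟩
  obtain ⟨N, hN⟩ := exists_uniform_level (T := T) (fun A => ∃ i, A ⊆ U i)
    (fun A B hAB ⟨i, hi⟩ => ⟨i, hAB.trans hi⟩) fun ξ => by
      obtain ⟨i, hi⟩ := Set.mem_iUnion.1 (hcover (Set.mem_univ ξ))
      obtain ⟨n, hn⟩ := exists_ball_subset ((hU i).mem_nhds hi)
      exact ⟨n, i, hn⟩
  choose i hi using hN
  obtain ⟨t, -, ht, htN⟩ := Set.exists_subset_image_finite_and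
    (f := fun ξ : T.Boundary => ξ N) (s := Set.univ) (p := fun A => ∀ ξ : T.Boundary, ξ N ∈ A)|>.1
    ⟨_, Set.image_univ.superset, finite_level N, Set.mem_range_self⟩
  classical
  refine ⟨ht.toFinset.image i, fun ξ _ => ?_⟩
  obtain ⟨η, hη, hξη⟩ := htN ξ
  exact Set.mem_biUnion (Finset.mem_coe.2 (Finset.mem_image_of_mem i (ht.mem_toFinset.2 hη)))
    (hi η (mem_ball_vertex.2 hξη.symm))

theorem isOpen_ball (ξ : T.Boundary) (n : ℕ) : IsOpen (T.ball (ξ n)) := by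
  refine isOpen_iff_mem_nhds.2 fun η hη => ?_
  rw [← mem_ball_vertex.1 hη]
  exact ball_mem_nhds η n

theorem Boundary.apply_eq_iff_dist_lt : ξ n = η n ↔ dist ξ η < (1 / 2 : ℝ) ^ n := by
  rcases eq_or_ne ξ η with rfl | hne
  · simp
  have hne' : ξ.vertex ≠ η.vertex := fun h => hne (Boundary.coe_injective h)
  rw [Boundary.dist_of_ne hne, pow_lt_pow_iff_right_of_lt_one₀ (by norm_num) (by norm_num)]
  refine ⟨fun h => ?_, PiNat.apply_eq_of_lt_firstDiff⟩
  by_contra! hle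
  exact PiNat.apply_firstDiff_ne hne' (Boundary.eq_of_le h _ hle)

theorem Boundary.exists_apply_eq_diagonal {ζ : ℕ → T.Boundary}
    (hζ : ∀ k, ζ (k + 1) k = ζ k k) : ∃ a : T.Boundary, ∀ k, a k = ζ k k :=
  ⟨⟨fun k => ζ k k, (ζ 0).vertex_zero, fun k => hζ k ▸ (ζ (k + 1)).isChild k⟩, fun _ => rfl⟩

theorem ChildOrders.apply_succ_ne_of_lt (h : o.lt (ξ n) (ξ (n + 1)) (η (n + 1))) :
    ξ (n + 1) ≠ η (n + 1) := by
  intro heq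
  have := o.isStrictTotalOrder (ξ n)
  rw [← heq] at h
  exact irrefl_of (fun a b : {w // T.IsChild (ξ n) w} => o.lt (ξ n) a.1 b.1)
    ⟨ξ (n + 1), ξ.isChild n⟩ h

theorem ChildOrders.lt_of_boundaryLT (h : o.boundaryLT ξ η) (hn : ξ n = η n)
    (hne : ξ (n + 1) ≠ η (n + 1)) : o.lt (ξ n) (ξ (n + 1)) (η (n + 1)) := by
  obtain ⟨m, hm, hlt⟩ := h
  rcases lt_trichotomy m n with hmn | rfl | hnm
  · exact absurd (Boundary.eq_of_le hn _ hmn) (apply_succ_ne_of_lt hlt)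
  · exact hlt
  · exact absurd (hm (n + 1) hnm) hne

/-- `g` maps the cone of ends through `ξ n` onto the cone of ends through `g ξ m`, preserving the
order and shifting levels by `m - n`. -/
structure MapsCone (o : T.ChildOrders) (g : T.Boundary ≃ₜ T.Boundary) (n m : ℕ)
    (ξ : T.Boundary) : Prop where
  apply_add_eq_iff : ∀ η ζ : T.Boundary, η n = ξ n → ∀ k,
    (ζ (n + k) = η (n + k) ↔ g ζ (m + k) = g η (m + k))
  boundaryLT : ∀ η ζ : T.Boundary, η n = ξ n → ζ n = ξ n → o.boundaryLT η ζ →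
    o.boundaryLT (g η) (g ζ)

namespace MapsCone

variable {f g h : T.Boundary ≃ₜ T.Boundary} {m k t : ℕ} {ζ : T.Boundary}

theorem apply_eq_iff (hg : MapsCone o g n m ξ) : η n = ξ n ↔ g η m = g ξ m :=
  hg.apply_add_eq_iff ξ η rfl 0

theorem congr (hg : MapsCone o g n m ξ) (hη : η n = ξ n) : MapsCone o g n m η where
  apply_add_eq_iff α β hα := hg.apply_add_eq_iff α β (hα.trans hη)
  boundaryLT α β hα hβ := hg.boundaryLT α β (hα.trans hη) (hβ.trans hη)

theorem add (hg : MapsCone o g n m ξ) (k : ℕ) : MapsCone o g (n + k) (m + k) ξ where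
  apply_add_eq_iff α β hα l := by
    rw [Nat.add_assoc, Nat.add_assoc]
    exact hg.apply_add_eq_iff α β (Boundary.eq_of_le hα n (n.le_add_right k)) (k + l)
  boundaryLT α β hα hβ := hg.boundaryLT α β (Boundary.eq_of_le hα n (n.le_add_right k))
    (Boundary.eq_of_le hβ n (n.le_add_right k))

theorem one (n : ℕ) (ξ : T.Boundary) : MapsCone o 1 n n ξ where
  apply_add_eq_iff _ _ _ _ := Iff.rfl
  boundaryLT _ _ _ _ h := h

theorem mul (hh : MapsCone o h m k (g ξ)) (hg : MapsCone o g n m ξ) :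
    MapsCone o (h * g) n k ξ where
  apply_add_eq_iff α β hα l :=
    (hg.apply_add_eq_iff α β hα l).trans (hh.apply_add_eq_iff _ _ (hg.apply_eq_iff.1 hα) l)
  boundaryLT α β hα hβ hlt :=
    hh.boundaryLT _ _ (hg.apply_eq_iff.1 hα) (hg.apply_eq_iff.1 hβ) (hg.boundaryLT α β hα hβ hlt)

theorem inv (hg : MapsCone o g n m ξ) : MapsCone o g⁻¹ m n (g ξ) := by
  have hcone (α : T.Boundary) (hα : α m = g ξ m) : g⁻¹ α n = ξ n :=
    hg.apply_eq_iff.2 (by simpa using hα)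
  refine ⟨fun α β hα k => ?_, fun α β hα hβ hlt => ?_⟩
  · simpa using (hg.apply_add_eq_iff (g⁻¹ α) (g⁻¹ β) (hcone α hα) k).symm
  · rcases o.boundaryLT_trichotomy (g⁻¹ α) (g⁻¹ β) with h | h | h
    · exact h
    · exact absurd (g⁻¹.injective h ▸ hlt) (o.boundaryLT_irrefl _)
    · have hlt' : o.boundaryLT β α := by
        simpa using hg.boundaryLT _ _ (hcone β hβ) (hcone α hα) h
      exact absurd hlt' (o.boundaryLT_asymm hlt)

theorem lt_apply_succ (hg : MapsCone o g n m ξ) (hη : η n = ξ n) (hζ : ζ n = ξ n)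
    (hlt : o.lt (η n) (η (n + 1)) (ζ (n + 1))) :
    o.lt (g η m) (g η (m + 1)) (g ζ (m + 1)) := by
  have heq : ζ n = η n := hζ.trans hη.symm
  refine ChildOrders.lt_of_boundaryLT (hg.boundaryLT η ζ hη hζ ⟨n, ?_, hlt⟩) ?_ ?_
  · exact Boundary.eq_of_le heq.symm
  · exact ((hg.apply_add_eq_iff η ζ hη 0).1 heq).symm
  · exact fun h => ChildOrders.apply_succ_ne_of_lt hlt
      ((hg.apply_add_eq_iff η ζ hη 1).2 h.symm).symm

/-- The images of a child under the powers of `g` cannot increase forever, as the vertex `ξ n` has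
finitely many children. -/
theorem not_lt_apply_succ (hg : MapsCone o g n n ξ) (hξ : g ξ n = ξ n) :
    ¬ o.lt (ξ n) (ξ (n + 1)) (g ξ (n + 1)) := by
  have := o.isStrictTotalOrder (ξ n)
  have : Finite {w // T.IsChild (ξ n) w} := finite_isChild (ξ n)
  have hwf := Finite.wellFounded_of_trans_of_irrefl
    (Function.swap fun a b : {w // T.IsChild (ξ n) w} => o.lt (ξ n) a.1 b.1)
  suffices hchild : ∀ (c : {w // T.IsChild (ξ n) w}) (η : T.Boundary), η n = ξ n →
      η (n + 1) = c → ¬ o.lt (η n) (η (n + 1)) (g η (n + 1)) from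
    hchild ⟨ξ (n + 1), ξ.isChild n⟩ ξ rfl rfl
  intro c
  induction c using hwf.induction with
  | _ c ih =>
    intro η hη hc hlt
    have hgη : g η n = ξ n := (hg.apply_eq_iff.1 hη).trans hξ
    refine ih ⟨g η (n + 1), hgη ▸ (g η).isChild n⟩ ?_ (g η) hgη rfl (hg.lt_apply_succ hη hgη hlt)
    rwa [hη, hc] at hlt

theorem apply_succ_eq (hg : MapsCone o g n n ξ) (hξ : g ξ n = ξ n) :
    g ξ (n + 1) = ξ (n + 1) := by
  have := o.isStrictTotalOrder (ξ n)
  rcases trichotomous_of (fun a b : {w // T.IsChild (ξ n) w} => o.lt (ξ n) a.1 b.1)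
    ⟨ξ (n + 1), ξ.isChild n⟩ ⟨g ξ (n + 1), hξ ▸ (g ξ).isChild n⟩ with h | h | h
  · exact absurd h (hg.not_lt_apply_succ hξ)
  · exact (congrArg Subtype.val h).symm
  · have hinv := hg.inv.not_lt_apply_succ (by simpa using hξ.symm)
    simp only [Homeomorph.inv_apply, Homeomorph.symm_apply_apply, hξ] at hinv
    exact absurd h hinv

theorem apply_eq_self (hg : MapsCone o g n n ξ) (hξ : g ξ n = ξ n) (hη : η n = ξ n) :
    g η = η := by
  have hη' : g η n = η n := (hg.apply_eq_iff.1 hη).trans (hξ.trans hη.symm)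
  have hlevel (k : ℕ) : g η (n + k) = η (n + k) := by
    induction k with
    | zero => exact hη'
    | succ k ih => exact ((hg.congr hη).add k).apply_succ_eq ih
  exact Boundary.ext (funext fun k => Boundary.eq_of_le (hlevel k) k (Nat.le_add_left k n))

end MapsCone

/-- `f` maps the cone of ends through `ξ n` into itself, preserving the order and shifting levels
by `t`. -/
structure ContractsCone (o : T.ChildOrders) (f : T.Boundary ≃ₜ T.Boundary) (n t : ℕ)
    (ξ : T.Boundary) : Prop where
  mapsCone : MapsCone o f n (n + t) ξ
  apply_eq : f ξ n = ξ n

namespace ContractsCone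

variable {f : T.Boundary ≃ₜ T.Boundary} {t : ℕ}

theorem apply_eq_of_apply_eq (hf : ContractsCone o f n t ξ) (hη : η n = ξ n) : f η n = ξ n :=
  (Boundary.eq_of_le (hf.mapsCone.apply_eq_iff.1 hη) n (n.le_add_right t)).trans hf.apply_eq

theorem pow (hf : ContractsCone o f n t ξ) (k : ℕ) : ContractsCone o (f ^ k) n (k * t) ξ := by
  induction k with
  | zero => exact ⟨by simpa using MapsCone.one n ξ, rfl⟩
  | succ k ih =>
    refine ⟨?_, ?_⟩
    · rw [pow_succ, Nat.succ_mul, ← Nat.add_assoc]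
      exact ((ih.mapsCone.congr hf.apply_eq).add t).mul hf.mapsCone
    · rw [pow_succ]
      exact ih.apply_eq_of_apply_eq hf.apply_eq

theorem pow_apply_eq (hf : ContractsCone o f n t ξ) (ht : t ≠ 0) (hη : η n = ξ n) (k : ℕ) :
    (f ^ k) η k = (f ^ k) ξ k :=
  Boundary.eq_of_le ((hf.pow k).mapsCone.apply_eq_iff.1 hη) k
    ((Nat.le_mul_of_pos_right k ht.bot_lt).trans (Nat.le_add_left _ _))

theorem exists_attracts (hf : ContractsCone o f n t ξ) (ht : t ≠ 0)
    (hξ : (T.ball (ξ n)).Nontrivial) : ∃ a, Attracts f (T.ball (ξ n)) a := by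
  obtain ⟨a, ha⟩ := Boundary.exists_apply_eq_diagonal (ζ := fun k => (f ^ k) ξ) fun k =>
    hf.pow_apply_eq ht hf.apply_eq k
  refine ⟨a, isOpen_ball ξ n, ?_, hξ, fun U hU => ?_⟩
  · exact mem_ball_vertex.2 ((ha n).trans (hf.pow n).apply_eq)
  · obtain ⟨N, hN⟩ := exists_ball_subset hU
    filter_upwards [eventually_ge_atTop N] with k hk η hη
    have hηa : (f ^ k) η k = a k := (hf.pow_apply_eq ht (mem_ball_vertex.1 hη) k).trans (ha k).symm
    exact hN (mem_ball_vertex.2 (Boundary.eq_of_le hηa N hk))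

theorem forall_apply_eq_or_attracts (hf : ContractsCone o f n t ξ) :
    (∀ η ∈ T.ball (ξ n), f η = η) ∨ ∃ a, Attracts f (T.ball (ξ n)) a := by
  rcases eq_or_ne t 0 with rfl | ht
  · exact Or.inl fun η hη => hf.mapsCone.apply_eq_self hf.apply_eq (mem_ball_vertex.1 hη)
  rcases (T.ball (ξ n)).subsingleton_or_nontrivial with hsub | hnontriv
  · exact Or.inl fun η hη =>
      hsub (mem_ball_vertex.2 (hf.apply_eq_of_apply_eq (mem_ball_vertex.1 hη))) hη
  · exact Or.inr (hf.exists_attracts ht hnontriv)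

end ContractsCone

end Cones

section Homotheties

variable {g : T.Boundary ≃ₜ T.Boundary}

/-- The ratio of a homothety of a nontrivial set is a quotient of two values of the metric, hence an
integral power of `1 / 2`. -/
theorem exists_apply_eq_iff_of_homothety {s : Set T.Boundary} {c : ℝ} (hc : 0 < c)
    (hg : ∀ y ∈ s, ∀ z ∈ s, dist (g y) (g z) = c * dist y z) :
    ∃ a b : ℕ, ∀ y ∈ s, ∀ z ∈ s, ∀ k, (y (a + k) = z (a + k) ↔ g y (b + k) = g z (b + k)) := by
  rcases s.subsingleton_or_nontrivial with hs | ⟨y, hy, z, hz, hne⟩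
  · exact ⟨0, 0, fun y hy z hz k => by simp [hs hy hz]⟩
  obtain ⟨a, b, hab⟩ : ∃ a b : ℕ, (1 / 2 : ℝ) ^ b = c * (1 / 2) ^ a := by
    have h := hg y hy z hz
    rw [Boundary.dist_of_ne hne, Boundary.dist_of_ne (g.injective.ne hne)] at h
    exact ⟨_, _, h⟩
  refine ⟨a, b, fun y hy z hz k => ?_⟩
  rw [Boundary.apply_eq_iff_dist_lt, Boundary.apply_eq_iff_dist_lt, hg y hy z hz, pow_add, pow_add,
    hab, mul_assoc, mul_lt_mul_iff_right₀ hc]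

theorem IsGoodOn.exists_mapsCone {n : ℕ} {ξ : T.Boundary} (hg : IsGoodOn o g (T.ball (ξ n))) :
    ∃ a b, MapsCone o g a b ξ := by
  obtain ⟨⟨c, hc, hdist⟩, hord⟩ := hg
  obtain ⟨m, hm⟩ := exists_ball_subset (g.isOpenMap.image_mem_nhds (ball_mem_nhds ξ n))
  obtain ⟨a, b, hab⟩ := exists_apply_eq_iff_of_homothety hc hdist
  have hξ : ξ ∈ T.ball (ξ n) := mem_ball_vertex.2 rfl
  have hball {α : T.Boundary} (hα : α (a + (n + m)) = ξ (a + (n + m))) : α ∈ T.ball (ξ n) :=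
    mem_ball_vertex.2 (Boundary.eq_of_le hα n (by omega))
  have hball_of_image {α : T.Boundary} (hα : g α (b + (n + m)) = g ξ (b + (n + m))) :
      α ∈ T.ball (ξ n) := by
    obtain ⟨β, hβ, hβα⟩ := hm (mem_ball_vertex.2 (Boundary.eq_of_le hα m (by omega)))
    exact g.injective hβα ▸ hβ
  refine ⟨a + (n + m), b + (n + m), fun α β hα k => ?_, fun α β hα hβ => ?_⟩
  · have hgα := (hab α (hball hα) ξ hξ (n + m)).1 hα
    rw [Nat.add_assoc a, Nat.add_assoc b]
    refine ⟨fun h => (hab β (hball ?_) α (hball hα) _).1 h,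
      fun h => (hab β (hball_of_image ?_) α (hball hα) _).2 h⟩
    · exact (Boundary.eq_of_le h _ (by omega)).trans hα
    · exact (Boundary.eq_of_le h _ (by omega)).trans hgα
  · exact hord α (hball hα) β (hball hβ)

theorem IsHigmanThompson.eventually_exists_mapsCone (hg : IsHigmanThompson o g) :
    ∀ᶠ n in atTop, ∀ ξ, ∃ m, MapsCone o g n m ξ := by
  have hlocal (ξ : T.Boundary) : ∃ n, ∀ η ∈ T.ball (ξ n), ∃ m, MapsCone o g n m η := by
    obtain ⟨n, hn⟩ := (isHigmanThompson_iff_local o g).1 hg ξ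
    obtain ⟨a, b, h⟩ := hn.exists_mapsCone
    exact ⟨a, fun η hη => ⟨b, h.congr (mem_ball_vertex.1 hη)⟩⟩
  choose n hn using hlocal
  obtain ⟨t, ht⟩ := CompactSpace.elim_nhds_subcover (fun ξ : T.Boundary => T.ball (ξ (n ξ)))
    fun ξ => ball_mem_nhds ξ (n ξ)
  filter_upwards [eventually_ge_atTop (t.sup n)] with N hN η
  obtain ⟨ξ, hξ, hη⟩ := Set.mem_iUnion₂.1 (ht.ge (Set.mem_univ η))
  obtain ⟨k, rfl⟩ := Nat.exists_eq_add_of_le ((Finset.le_sup hξ).trans hN)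
  obtain ⟨m, hm⟩ := hn ξ η hη
  exact ⟨m + k, hm.add k⟩

end Homotheties

end LFRootedTree

/-! ### Paths of cones -/

section Sequences

variable {S : ℕ → ℤ}

theorem exists_ge_forall_le_of_bddBelow (hS : BddBelow (Set.range S)) (n : ℕ) :
    ∃ i ≥ n, ∀ l ≥ i, S i ≤ S l := by
  have hbdd : BddBelow (S '' Set.Ici n) := hS.mono (Set.image_subset_range _ _)
  obtain ⟨i, hi, heq⟩ := Int.csInf_mem (Set.nonempty_Ici.image S) hbdd
  exact ⟨i, hi, fun l hl => heq.trans_le (csInf_le hbdd ⟨l, le_trans hi hl, rfl⟩)⟩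

theorem exists_le_forall_lt_of_not_bddBelow (hS : ¬ BddBelow (Set.range S)) (M : ℤ) :
    ∃ j, S j ≤ M ∧ ∀ l < j, S j < S l := by
  classical
  have hex : ∃ j, S j ≤ M := by
    obtain ⟨_, ⟨j, rfl⟩, hj⟩ := not_bddBelow_iff.1 hS M
    exact ⟨j, hj.le⟩
  exact ⟨Nat.find hex, Nat.find_spec hex, fun l hl =>
    (Nat.find_spec hex).trans_lt (not_le.1 (Nat.find_min hex hl))⟩

end Sequences

namespace LFRootedTree

variable {V : Type*} {T : LFRootedTree V} {o : T.ChildOrders}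

section Paths

variable {w : ℕ → (T.Boundary ≃ₜ T.Boundary)} {ξ : T.Boundary} {N : ℕ} {S : ℕ → ℤ} {i j : ℕ}

/-- Along the path `w 0 ξ, w 1 ξ, …`, the `i`-th step maps every cone at level at least `N` around
`w i ξ` onto a cone, shifting levels by `S (i + 1) - S i`. -/
def TracksLevels (o : T.ChildOrders) (w : ℕ → (T.Boundary ≃ₜ T.Boundary)) (ξ : T.Boundary) (N : ℕ)
    (S : ℕ → ℤ) : Prop :=
  ∀ (i a b : ℕ), N ≤ a → (b : ℤ) = a + S (i + 1) - S i →
    MapsCone o (w (i + 1) * (w i)⁻¹) a b (w i ξ)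

theorem exists_tracksLevels (hw : ∀ i η, ∃ m, MapsCone o (w (i + 1) * (w i)⁻¹) N m η)
    (ξ : T.Boundary) : ∃ S, TracksLevels o w ξ N S := by
  choose m hm using hw
  refine ⟨fun i => ∑ l ∈ Finset.range i, ((m l (w l ξ) : ℤ) - N), fun i a b ha hb => ?_⟩
  obtain ⟨k, rfl⟩ := Nat.exists_eq_add_of_le ha
  obtain rfl : b = m i (w i ξ) + k := by
    simp only [Finset.sum_range_succ] at hb
    push_cast at hb
    omega
  exact (hm i (w i ξ)).add k

namespace TracksLevels

theorem mapsCone (h : TracksLevels o w ξ N S) (hij : i ≤ j) {a b : ℕ}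
    (ha : ∀ l, i ≤ l → l < j → (N : ℤ) ≤ a + S l - S i) (hb : (b : ℤ) = a + S j - S i) :
    MapsCone o (w j * (w i)⁻¹) a b (w i ξ) := by
  induction j, hij using Nat.le_induction generalizing b with
  | base =>
    obtain rfl : b = a := by omega
    rw [mul_inv_cancel]
    exact MapsCone.one b _
  | succ j hij ih =>
    have hNj : (N : ℤ) ≤ a + S j - S i := ha j hij j.lt_succ_self
    obtain ⟨c, hc⟩ := Int.eq_ofNat_of_zero_le ((Int.natCast_nonneg N).trans hNj)
    have hij' := ih (fun l hl hlj => ha l hl (hlj.trans j.lt_succ_self)) hc.symm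
    have hstep : MapsCone o (w (j + 1) * (w j)⁻¹) c b ((w j * (w i)⁻¹) (w i ξ)) := by
      simpa using h j c b (by omega) (by omega)
    simpa [mul_assoc] using hstep.mul hij'

theorem exists_contractsCone_of_bddBelow (h : TracksLevels o w ξ N S)
    (hS : BddBelow (Set.range S)) :
    ∃ i j t, i < j ∧ ContractsCone o (w j * (w i)⁻¹) N t (w i ξ) := by
  have hinf : {i | ∀ l ≥ i, S i ≤ S l}.Infinite := Set.infinite_of_forall_exists_gt fun n => by
    obtain ⟨i, hi, hmin⟩ := exists_ge_forall_le_of_bddBelow hS (n + 1)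
    exact ⟨i, hmin, hi⟩
  obtain ⟨i, hi, j, -, hij, hv⟩ := hinf.exists_lt_map_eq_of_mapsTo
    (f := fun i => w i ξ N) (fun i _ => Set.mem_range_self (w i ξ)) (finite_level N)
  obtain ⟨t, ht⟩ := Int.eq_ofNat_of_zero_le (sub_nonneg.2 (hi j hij.le))
  refine ⟨i, j, t, hij, h.mapsCone hij.le (fun l hl _ => ?_) (by push_cast; omega), ?_⟩
  · have := hi l hl
    omega
  · simpa using hv.symm

theorem exists_contractsCone_of_not_bddBelow (h : TracksLevels o w ξ N S)
    (hS : ¬ BddBelow (Set.range S)) :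
    ∃ i, ∀ M, ∃ j t, i < j ∧ M < t ∧ w j ξ N = w i ξ N ∧
      ContractsCone o (w i * (w j)⁻¹) N t (w i ξ) := by
  obtain ⟨v, hv⟩ : ∃ v, ∀ M, ∃ j, S j ≤ M ∧ (∀ l < j, S j < S l) ∧ w j ξ N = v := by
    by_contra! hcon
    choose M hM using hcon
    obtain ⟨B, hB⟩ := ((finite_level (T := T) N).image M).bddBelow
    obtain ⟨j, hj, hlt⟩ := exists_le_forall_lt_of_not_bddBelow hS B
    exact hM (w j ξ N) j (hj.trans (hB ⟨_, ⟨w j ξ, rfl⟩, rfl⟩)) hlt rfl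
  obtain ⟨i, -, hi, hiv⟩ := hv 0
  refine ⟨i, fun M => ?_⟩
  obtain ⟨j, hjM, hj, hjv⟩ := hv (S i - M - 1)
  have hij : i < j := by
    by_contra! hji
    have : S i ≤ S j := hji.eq_or_lt.elim (fun h => h ▸ le_rfl) fun h => (hi j h).le
    omega
  obtain ⟨t, ht⟩ := Int.eq_ofNat_of_zero_le (sub_nonneg.2 (hj i hij).le)
  have hji : w j ξ N = w i ξ N := hjv.trans hiv.symm
  have hinv : MapsCone o (w i * (w j)⁻¹) N (N + t) (w j ξ) := by
    have hfwd : MapsCone o (w j * (w i)⁻¹) (N + t) N (w i ξ) := by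
      refine h.mapsCone hij.le (fun l _ hl => ?_) (by push_cast; omega)
      have := hj l hl
      push_cast
      omega
    simpa using hfwd.inv
  have hcone : ContractsCone o (w i * (w j)⁻¹) N t (w j ξ) := ⟨hinv, by simpa using hji.symm⟩
  exact ⟨j, t, hij, by omega, hji, hinv.congr hji.symm,
    (hcone.apply_eq_of_apply_eq hji.symm).trans hji⟩

end TracksLevels

end Paths

section HigmanThompson

variable {g : T.Boundary ≃ₜ T.Boundary} {H : Subgroup (T.Boundary ≃ₜ T.Boundary)}
  {w : ℕ → (T.Boundary ≃ₜ T.Boundary)} {N : ℕ} {ξ : T.Boundary}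

theorem ContractsCone.isTameAt {n t : ℕ} (h : ContractsCone o (g ^ n) N t ξ) (hn : n ≠ 0) :
    IsTameAt g ξ := by
  rcases h.forall_apply_eq_or_attracts with hfix | ⟨a, ha⟩
  · exact Or.inl ⟨n, hn, mem_of_superset (ball_mem_nhds ξ N) hfix⟩
  · exact Or.inr (Or.inl ⟨n, hn, _, a, ha, mem_ball_vertex.2 rfl⟩)

/-- The attracting point of one `(g ^ n)⁻¹` is fixed by all the others, which commute with it, so it
lies in their images of the cone; these shrink to `ξ`. -/
theorem isTameAt_of_forall_contractsCone_inv
    (h : ∀ M, ∃ n t : ℕ, n ≠ 0 ∧ M < t ∧ (g ^ n) ξ N = ξ N ∧ ContractsCone o (g ^ n)⁻¹ N t ξ) :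
    IsTameAt g ξ := by
  obtain ⟨n, t, hn, -, -, hc⟩ := h 0
  rcases hc.forall_apply_eq_or_attracts with hfix | ⟨a, ha⟩
  · refine Or.inl ⟨n, hn, mem_of_superset (ball_mem_nhds ξ N) fun η hη => ?_⟩
    simpa using (congrArg (g ^ n) (hfix η hη)).symm
  suffices haξ : a = ξ from Or.inr (Or.inr ⟨n, hn, _, haξ ▸ ha⟩)
  refine Boundary.ext (funext fun M => ?_)
  obtain ⟨m, t, -, hMt, hm, hcm⟩ := h M
  have haN : a N = ξ N := mem_ball_vertex.1 ha.mem
  have hcomm : Commute (g ^ m)⁻¹ (g ^ n)⁻¹ := ((Commute.refl g).pow_pow m n).inv_inv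
  have hfix : (g ^ m)⁻¹ a = a :=
    ha.apply_eq_of_commute hcomm (mem_ball_vertex.2 (hcm.apply_eq_of_apply_eq haN))
  have himage : (g ^ m)⁻¹ a (N + t) = (g ^ m)⁻¹ ((g ^ m) ξ) (N + t) :=
    (hcm.mapsCone.congr hm).apply_eq_iff.1 (haN.trans hm.symm)
  rw [hfix, show (g ^ m)⁻¹ ((g ^ m) ξ) = ξ from (g ^ m).symm_apply_apply ξ] at himage
  exact Boundary.eq_of_le himage M (hMt.le.trans (Nat.le_add_left t N))

theorem IsHigmanThompson.isTameAt (hg : IsHigmanThompson o g) (ξ : T.Boundary) :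
    IsTameAt g ξ := by
  obtain ⟨N, hN⟩ := hg.eventually_exists_mapsCone.exists
  have hcomm (i : ℕ) : Commute (g ^ i) g := (Commute.refl g).pow_left i
  obtain ⟨S, hS⟩ := exists_tracksLevels (o := o) (w := fun i => g ^ i) (N := N)
    (fun i => by simpa [pow_succ'] using hN) ξ
  by_cases hbdd : BddBelow (Set.range S)
  · obtain ⟨i, j, t, hij, hc⟩ := hS.exists_contractsCone_of_bddBelow hbdd
    simp only [← pow_sub g hij.le] at hc
    exact (hc.isTameAt (Nat.sub_ne_zero_of_lt hij)).of_commute (hcomm i)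
  · obtain ⟨i, hi⟩ := hS.exists_contractsCone_of_not_bddBelow hbdd
    refine IsTameAt.of_commute (hcomm i)
      (isTameAt_of_forall_contractsCone_inv (o := o) (N := N) fun M => ?_)
    obtain ⟨j, t, hij, hMt, hv, hc⟩ := hi M
    have hinv : g ^ i * (g ^ j)⁻¹ = (g ^ (j - i))⁻¹ := by
      rw [pow_sub g hij.le, mul_inv_rev, inv_inv]
    have hpow : (g ^ (j - i)) ((g ^ i) ξ) = (g ^ j) ξ := by
      rw [← Homeomorph.mul_apply, ← pow_add, Nat.sub_add_cancel hij.le]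
    simp only [hinv] at hc
    exact ⟨j - i, t, Nat.sub_ne_zero_of_lt hij, hMt, by rw [hpow, hv], hc⟩

theorem exists_mem_hyperbolicSet_of_injective (hw : ∀ i, w i ∈ H)
    (hinj : Injective fun i => w i ξ)
    (hN : ∀ i η, ∃ m, MapsCone o (w (i + 1) * (w i)⁻¹) N m η) : ∃ g ∈ H, ξ ∈ hyperbolicSet g := by
  obtain ⟨S, hS⟩ := exists_tracksLevels hN ξ
  obtain ⟨i, f, t, hfH, hf, hc⟩ : ∃ i, ∃ f, ∃ t, f ∈ H ∧ f (w i ξ) ≠ w i ξ ∧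
      ContractsCone o f N t (w i ξ) := by
    by_cases hbdd : BddBelow (Set.range S)
    · obtain ⟨i, j, t, hij, hc⟩ := hS.exists_contractsCone_of_bddBelow hbdd
      refine ⟨i, _, t, H.mul_mem (hw j) (H.inv_mem (hw i)), fun h => hij.ne' (hinj ?_), hc⟩
      simpa using h
    · obtain ⟨i, hi⟩ := hS.exists_contractsCone_of_not_bddBelow hbdd
      obtain ⟨j, t, hij, -, -, hc⟩ := hi 0
      refine ⟨i, _, t, H.mul_mem (hw i) (H.inv_mem (hw j)), fun h => hij.ne' (hinj ?_), hc⟩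
      simpa using (congrArg (w j * (w i)⁻¹) h).symm
  rcases hc.forall_apply_eq_or_attracts with hfix | ⟨a, ha⟩
  · exact absurd (hfix _ (mem_ball_vertex.2 rfl)) hf
  · have hmem : w i ξ ∈ hyperbolicSet f :=
      Attracts.not_isLocallyPeriodicAt (p := 1) (by simpa using ha) (mem_ball_vertex.2 rfl)
    have hconj : SemiconjBy (w i)⁻¹ f ((w i)⁻¹ * f * w i) := by simp [SemiconjBy, mul_assoc]
    refine ⟨_, H.mul_mem (H.mul_mem (H.inv_mem (hw i)) hfH) (hw i),
      fun h => hmem (.of_semiconjBy hconj ?_)⟩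
    simpa using h

theorem exists_mem_hyperbolicSet (hH : H ≤ T.higmanThompson o) (hfg : H.FG)
    (hfin : ¬ HasFiniteOrbit H) (ξ : T.Boundary) : ∃ g ∈ H, ξ ∈ hyperbolicSet g := by
  obtain ⟨S, rfl, hS⟩ := (Subgroup.fg_iff H).1 hfg
  have hgen (s : T.Boundary ≃ₜ T.Boundary) (hs : s ∈ S ∪ S⁻¹) : IsHigmanThompson o s :=
    hH (hs.elim (fun h => Subgroup.subset_closure h)
      fun h => inv_mem_iff.1 (Subgroup.subset_closure h))
  obtain ⟨N, hN⟩ := ((eventually_all_finite (hS.union hS.inv)).2 fun s hs =>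
    (hgen s hs).eventually_exists_mapsCone).exists
  obtain ⟨w, hw, hstep, hinj⟩ := exists_seq_injective_smul (x := ξ) hS
    fun h => hfin (.of_finite_orbit h)
  exact exists_mem_hyperbolicSet_of_injective hw hinj fun i => hN _ (hstep i)

end HigmanThompson

end LFRootedTree

theorem theoremB {V : Type*} (T : LFRootedTree V) (o : T.ChildOrders)
    (H : Subgroup (T.Boundary ≃ₜ T.Boundary)) (hH : H ≤ T.higmanThompson o) (hfg : H.FG) :
    HasFiniteOrbit H ∨ HasPingPongPair H :=
  or_iff_not_imp_left.2 fun hfin =>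
    hasPingPongPair_of_isTameAt (fun _ hg => LFRootedTree.IsHigmanThompson.isTameAt (hH hg))
      (LFRootedTree.exists_mem_hyperbolicSet hH hfg hfin) hfin
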